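/- Let $U\subset\mathbb R^2$ be a bounded $C^2$ domain, $T,\varepsilon,\eta>0$, $g\in L^2(U)$, and let $\phi\in C^\infty(\mathbb R)$ be nondecreasing with $\phi(s)=-1$ for $s\le -1$, $\phi(s)=s$ for $0<s<1$ and $\phi(s)=2$ for $s\ge 2$. Let $(e_i)_{i\ge 1}$ be an orthogonal basis of $H^1(U)$ consisting of eigenfunctions of $-\Delta$ with homogeneous Neumann boundary conditions, normalized by $\|e_i\|_{L^2(U)}=1$, that is, functions $e_i\in C^2(U)\cap C^1(\overline U)$ with $-\Delta e_i=\lambda_i e_i$ in $U$ and $\partial_n e_i=0$ on $\partial U$. For $N\in\mathbb N$ let $V_N=\operatorname{Span}\{e_1,\dots,e_N\}$, let $\pi_N$ be the $L^2(U)$-orthogonal projection on $V_N$, and let $g_N=\pi_N[g]$. Given $(u_0,z_0)\in[L^2(U)]^2$ and an interval $J=[0,\tau)$ or $J=[0,\tau]$ with $\tau>0$, a Galerkin solution on $J$ is a pair $(u_N,z_N)$ with $u_N(t),z_N(t)\in V_N$ for $t\in J$, with $u_N(0)=\pi_N[u_0]$, $z_N(0)=\pi_N[z_0]$, and such that for every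 $t\in J$ and every $\psi\in V_N$ $$\frac{d}{dt}\int_U u_N(t)\psi\,dx=-\int_U(\eta+\phi(z_N(t))^2)\nabla u_N(t)\cdot\nabla\psi\,dx-\int_U(u_N(t)-g_N)\psi\,dx,$$ $$\frac{d}{dt}\int_U z_N(t)\psi\,dx=-2\varepsilon\int_U\nabla z_N(t)\cdot\nabla\psi\,dx-\int_U\phi'(z_N(t))\phi(z_N(t))|\nabla u_N(t)|^2\psi\,dx+\int_U\frac{1-z_N(t)}{2\varepsilon}\psi\,dx$$ (with one-sided derivatives at the endpoints belonging to $J$). **Proposition 2.5** (Existence of weak approximate solutions in $[0,T]$). Let $(u_0,z_0)\in[L^2(U)]^2$. There is a constant $C>0$, independent of $N$, such that the following holds for every $N$. 1. If $0<t_N\le T$ and $(u_N,z_N)$ is a Galerkin solution on $J=[0,t_N)$ or on $J=[0,t_N]$, then $$\sup_{t\in J}\|u_N(t)\|_{L^2(U)}^2+\int_0^{t_N}\|\nabla u_N(s)\|_{L^2(U)}^2\,ds\le C,\qquad \sup_{t\in J}\|z_N(t)\|_{L^2(U)}^2+\int_0^{t_N}\|\nabla z_N(s)\|_{L^2(U)}^2\,ds\le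 C.$$ 2. Every such $(u_N,z_N)$ extends to a Galerkin solution on $[0,T]$, which satisfies the same two bounds with $T$ in place of $t_N$ (so there is no blow-up before time $T$). 3. A Galerkin solution on $[0,T]$ exists, and it satisfies the same two bounds on $[0,T]$. -/

import Mathlib

noncomputable section

namespace AmbrosioTortorelli

/-- The Euclidean plane. -/
abbrev Plane : Type := EuclideanSpace ℝ (Fin 2)

/-- `ρ` is a `C²` defining function of the open set `U` in the neighbourhood `W` of `p`:
inside `W`, `U` is the sublevel set `{ρ < 0}`, and the gradient of `ρ` does not vanish at `p`. -/
structure IsLocalDefiningFunction (U : Set Plane) (p : Plane) (W : Set Plane) (ρ : Plane → ℝ) :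
    Prop where
  isOpen : IsOpen W
  mem : p ∈ W
  contDiffOn : ContDiffOn ℝ 2 ρ W
  gradient_ne_zero : gradient ρ p ≠ 0
  inter_eq : U ∩ W = {x ∈ W | ρ x < 0}

/-- A bounded `C²` domain of the plane: open, connected (in particular non-empty), bounded, with
boundary locally given by a `C²` defining function. -/
structure IsBoundedC2Domain (U : Set Plane) : Prop where
  isOpen : IsOpen U
  isConnected : IsConnected U
  isBounded : Bornology.IsBounded U
  boundary : ∀ p ∈ frontier U, ∃ (W : Set Plane) (ρ : Plane → ℝ), IsLocalDefiningFunction U p W ρ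

/-- `ν` is the outward unit normal of `U` at the boundary point `p`. -/
def IsOutwardUnitNormal (U : Set Plane) (p ν : Plane) : Prop :=
  ∃ (W : Set Plane) (ρ : Plane → ℝ), IsLocalDefiningFunction U p W ρ ∧
    ν = ‖gradient ρ p‖⁻¹ • gradient ρ p

/-- `e ∈ C²(U) ∩ C¹(closure U)` solves `-Δ e = lam e` in `U` and `∂ₙ e = 0` on `∂U`. The gradient
on `∂U` is the continuous extension of the gradient in `U`. -/
structure IsNeumannEigenfunction (U : Set Plane) (lam : ℝ) (e : Plane → ℝ) : Prop where
  contDiffOn : ContDiffOn ℝ 2 e U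
  continuousOn : ContinuousOn e (closure U)
  eigen : ∀ x ∈ U, -(Laplacian.laplacian e x) = lam * e x
  neumann : ∃ G : Plane → Plane, ContinuousOn G (closure U) ∧ Set.EqOn G (gradient e) U ∧
    ∀ p ∈ frontier U, ∀ ν : Plane, IsOutwardUnitNormal U p ν → inner ℝ (G p) ν = 0

/-- `v ∈ H¹(U)` with weak gradient `Dv`. -/
structure IsH1 (U : Set Plane) (v : Plane → ℝ) (Dv : Plane → Plane) : Prop where
  memLp : MeasureTheory.MemLp v 2 (MeasureTheory.volume.restrict U)
  memLp_grad : MeasureTheory.MemLp Dv 2 (MeasureTheory.volume.restrict U)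
  weak : ∀ ξ : Plane → ℝ, ContDiff ℝ (⊤ : ℕ∞) ξ → HasCompactSupport ξ → tsupport ξ ⊆ U →
    ∫ x in U, v x • gradient ξ x = -∫ x in U, ξ x • Dv x

/-- The span `V_N` of the first `N` functions of the sequence `e`. -/
def galerkinSpace (e : ℕ → Plane → ℝ) (N : ℕ) : Submodule ℝ (Plane → ℝ) :=
  Submodule.span ℝ (e '' {i | i < N})

/-- `e` is an orthogonal basis of `H¹(U)` made of eigenfunctions of `-Δ` with homogeneous Neumann
boundary conditions (eigenvalues `lam`), normalized in `L²(U)`. -/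
structure IsNeumannEigenbasis (U : Set Plane) (lam : ℕ → ℝ) (e : ℕ → Plane → ℝ) : Prop where
  eigenfunction : ∀ i, IsNeumannEigenfunction U (lam i) (e i)
  normalized : ∀ i, ∫ x in U, e i x ^ 2 = 1
  orthogonal : ∀ i j, i ≠ j →
    ∫ x in U, (e i x * e j x + inner ℝ (gradient (e i) x) (gradient (e j) x)) = 0
  dense : ∀ (v : Plane → ℝ) (Dv : Plane → Plane), IsH1 U v Dv → ∀ δ : ℝ, 0 < δ →
    ∃ N : ℕ, ∃ w ∈ galerkinSpace e N,
      ∫ x in U, ((v x - w x) ^ 2 + ‖Dv x - gradient w x‖ ^ 2) < δ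

/-- The smooth nondecreasing cutoff function. -/
structure IsCutoff (φ : ℝ → ℝ) : Prop where
  contDiff : ContDiff ℝ (⊤ : ℕ∞) φ
  monotone : Monotone φ
  left : ∀ s, s ≤ -1 → φ s = -1
  middle : ∀ s, 0 < s → s < 1 → φ s = s
  right : ∀ s, 2 ≤ s → φ s = 2

/-- `w` is the `L²(U)`-orthogonal projection of `f` on the space `V`. -/
def IsL2Projection (U : Set Plane) (V : Submodule ℝ (Plane → ℝ)) (f w : Plane → ℝ) : Prop :=
  w ∈ V ∧ ∀ ψ ∈ V, ∫ x in U, (f x - w x) * ψ x = 0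

/-- `(u, z)` solves on the time interval `J` (which contains `0`) the Galerkin system in `V_N`
`∂ₜ u = π_N[div((η + φ(z)²) ∇u)] - (u - π_N g)`,
`∂ₜ z = 2 ε Δz - π_N[φ'(z) φ(z) |∇u|²] + (1 - z) / (2 ε)`,
with `u(0) = π_N u₀`, `z(0) = π_N z₀` and homogeneous Neumann conditions, in the distributional
sense: the equations are tested with every `ψ ∈ V_N`, the divergence and the Laplacian being
integrated by parts without boundary term. -/
structure IsGalerkinSolution (U : Set Plane) (φ : ℝ → ℝ) (ε η : ℝ) (g u₀ z₀ : Plane → ℝ)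
    (e : ℕ → Plane → ℝ) (N : ℕ) (J : Set ℝ) (u z : ℝ → Plane → ℝ) : Prop where
  mem_u : ∀ t ∈ J, u t ∈ galerkinSpace e N
  mem_z : ∀ t ∈ J, z t ∈ galerkinSpace e N
  init_u : IsL2Projection U (galerkinSpace e N) u₀ (u 0)
  init_z : IsL2Projection U (galerkinSpace e N) z₀ (z 0)
  eq_u : ∃ gN : Plane → ℝ, IsL2Projection U (galerkinSpace e N) g gN ∧
    ∀ t ∈ J, ∀ ψ ∈ galerkinSpace e N,
      HasDerivWithinAt (fun s => ∫ x in U, u s x * ψ x)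
        (-(∫ x in U, (η + φ (z t x) ^ 2) * inner ℝ (gradient (u t) x) (gradient ψ x))
          - ∫ x in U, (u t x - gN x) * ψ x) J t
  eq_z : ∀ t ∈ J, ∀ ψ ∈ galerkinSpace e N,
      HasDerivWithinAt (fun s => ∫ x in U, z s x * ψ x)
        (-(2 * ε * ∫ x in U, inner ℝ (gradient (z t) x) (gradient ψ x))
          - (∫ x in U, deriv φ (z t x) * φ (z t x) * ‖gradient (u t) x‖ ^ 2 * ψ x)
          + ∫ x in U, (1 - z t x) / (2 * ε) * ψ x) J t

/-- `sup_{t ∈ J} ‖u(t)‖²_{L²(U)} + ∫_J ‖∇u(s)‖²_{L²(U)} ds ≤ C`, the supremum and the integral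
being finite. -/
def EnergyBound (U : Set Plane) (J : Set ℝ) (u : ℝ → Plane → ℝ) (C : ℝ) : Prop :=
  BddAbove (Set.range fun t : J => ∫ x in U, u t x ^ 2) ∧
  MeasureTheory.IntegrableOn (fun s => ∫ x in U, ‖gradient (u s) x‖ ^ 2) J ∧
  (⨆ t : J, ∫ x in U, u t x ^ 2) + ∫ s in J, ∫ x in U, ‖gradient (u s) x‖ ^ 2 ≤ C

end AmbrosioTortorelli

end

/-!
In coordinates that are orthonormal for `L²(U)`, the Galerkin system is an ordinary differential
equation `x' = F x` with a locally Lipschitz field `F`. Testing the equations with the solution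
itself, the coupling term contributes `-∫ φ'(z) φ(z) z |∇u|² ≤ 0`, because `s φ(s) φ'(s) ≥ 0`;
the remaining terms give `⟪F x, x⟫ ≤ κ - c ∫ (|∇u|² + |∇z|²)`. The bound `⟪F x, x⟫ ≤ κ` rules out
blow-up, and its refinement, integrated in time for each component, gives the energy bounds, with
constants independent of `N` because orthogonal projections do not increase the norms of the data.
A local solution inherits all this from the global one, with which it agrees by uniqueness.
-/

open MeasureTheory Set Filter
open scoped RealInnerProductSpace Gradient Topology

namespace AmbrosioTortorelli

section IntegralCurves

variable {X : Type*} [NormedAddCommGroup X]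

lemma hasDerivWithinAt_Ici_of_mem_Ico [NormedSpace ℝ X] {x : ℝ → X} {x' : X} {s T : ℝ}
    (h : HasDerivWithinAt x x' (Icc 0 T) s) (hs : s ∈ Ico 0 T) :
    HasDerivWithinAt x x' (Ici s) s :=
  h.mono_of_mem_nhdsWithin (mem_of_superset (Icc_mem_nhdsGE hs.2) (Icc_subset_Icc_left hs.1))

lemma hasDerivWithinAt_withLp_prod_iff [NormedSpace ℝ X] {Y : Type*}
    [NormedAddCommGroup Y] [NormedSpace ℝ Y] {x : ℝ → WithLp 2 (X × Y)} {x' : WithLp 2 (X × Y)}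
    {J : Set ℝ} {t : ℝ} :
    HasDerivWithinAt x x' J t ↔ HasDerivWithinAt (fun s => (x s).fst) x'.fst J t ∧
      HasDerivWithinAt (fun s => (x s).snd) x'.snd J t := by
  let L := WithLp.prodContinuousLinearEquiv 2 ℝ X Y
  refine ⟨fun h => ?_, fun h => L.symm.hasFDerivAt.comp_hasDerivWithinAt t (h.1.prodMk h.2)⟩
  have hL : HasDerivWithinAt (fun s => L (x s)) (L x') J t :=
    L.hasFDerivAt.comp_hasDerivWithinAt t h
  exact ⟨(ContinuousLinearMap.fst ℝ X Y).hasFDerivAt.comp_hasDerivWithinAt t hL,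
    (ContinuousLinearMap.snd ℝ X Y).hasFDerivAt.comp_hasDerivWithinAt t hL⟩

theorem exists_isIntegralCurveOn_of_bounded [NormedSpace ℝ X] [ProperSpace X] {F : X → X}
    (hF : LocallyLipschitz F) {L : ℝ} (hL : ∀ x, ‖F x‖ ≤ L) (x₀ : X) {T : ℝ} (hT : 0 ≤ T) :
    ∃ x : ℝ → X, x 0 = x₀ ∧ IsIntegralCurveOn x (fun _ => F) (Icc 0 T) := by
  have hL₀ : 0 ≤ L := (norm_nonneg _).trans (hL 0)
  obtain ⟨K, hK⟩ := hF.locallyLipschitzOn.exists_lipschitzOnWith_of_compact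
    (isCompact_closedBall x₀ (L * T))
  have hPL : IsPicardLindelof (fun _ => F) (⟨0, le_rfl, hT⟩ : Icc 0 T) x₀
      ⟨L * T, mul_nonneg hL₀ hT⟩ 0 ⟨L, hL₀⟩ K := by
    refine .of_time_independent (fun x _ => hL x) hK ?_
    change L * max (T - 0) (0 - 0) ≤ L * T - 0
    simp [hT]
  exact hPL.exists_eq_forall_mem_Icc_hasDerivWithinAt₀

theorem eqOn_of_isIntegralCurveOn_Icc [NormedSpace ℝ X] {F : X → X} (hF : LocallyLipschitz F)
    {x y : ℝ → X} {T : ℝ} (hx : IsIntegralCurveOn x (fun _ => F) (Icc 0 T))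
    (hy : IsIntegralCurveOn y (fun _ => F) (Icc 0 T)) (h₀ : x 0 = y 0) : EqOn x y (Icc 0 T) := by
  set s := x '' Icc 0 T ∪ y '' Icc 0 T
  have hs : IsCompact s := (isCompact_Icc.image_of_continuousOn hx.continuousOn).union
    (isCompact_Icc.image_of_continuousOn hy.continuousOn)
  obtain ⟨K, hK⟩ := hF.locallyLipschitzOn.exists_lipschitzOnWith_of_compact hs
  exact ODE_solution_unique_of_mem_Icc_right (v := fun _ => F) (s := fun _ => s) (fun _ _ => hK)
    hx.continuousOn
    (fun t ht => hasDerivWithinAt_Ici_of_mem_Ico (hx t (Ico_subset_Icc_self ht)) ht)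
    (fun t ht => .inl (mem_image_of_mem x (Ico_subset_Icc_self ht)))
    hy.continuousOn
    (fun t ht => hasDerivWithinAt_Ici_of_mem_Ico (hy t (Ico_subset_Icc_self ht)) ht)
    (fun t ht => .inr (mem_image_of_mem y (Ico_subset_Icc_self ht))) h₀

variable [InnerProductSpace ℝ X]

theorem norm_sq_add_integral_le {a a' : ℝ → X} {d : ℝ → ℝ} {k T : ℝ}
    (ha : ∀ t ∈ Icc 0 T, HasDerivWithinAt a (a' t) (Icc 0 T) t)
    (hd : ContinuousOn d (Icc 0 T)) (h : ∀ t ∈ Icc 0 T, ⟪a' t, a t⟫ ≤ k - d t) :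
    ∀ t ∈ Icc 0 T, ‖a t‖ ^ 2 + 2 * ∫ s in (0 : ℝ)..t, d s ≤ ‖a 0‖ ^ 2 + 2 * k * t := by
  intro t ht
  have hsub : Icc 0 t ⊆ Icc 0 T := Icc_subset_Icc_right ht.2
  have hmem {s} (hs : s ∈ Ico 0 t) : s ∈ Icc 0 T := hsub (Ico_subset_Icc_self hs)
  have hcont : ContinuousOn a (Icc 0 t) := fun s hs =>
    ((ha s (hsub hs)).mono hsub).continuousWithinAt
  have hdt : ContinuousOn d (Icc 0 t) := hd.mono hsub
  have hint : IntervalIntegrable d volume 0 t := hdt.intervalIntegrable_of_Icc ht.1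
  have hle : ‖a t‖ ^ 2 - ‖a 0‖ ^ 2 ≤ ∫ s in (0 : ℝ)..t, 2 * (k - d s) :=
    intervalIntegral.sub_le_integral_of_hasDeriv_right_of_le_Ico
      (g' := fun s => 2 * ⟪a s, a' s⟫) ht.1 (hcont.norm.pow 2)
      (fun s hs => ((hasDerivWithinAt_Ici_of_mem_Ico ((ha s (hmem hs)).mono hsub) hs).mono
        Ioi_subset_Ici_self).norm_sq)
      (continuousOn_const.mul (continuousOn_const.sub hdt)).integrableOn_Icc
      (fun s hs => by rw [real_inner_comm]; linarith [h s (hmem hs)])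
  rw [intervalIntegral.integral_const_mul, intervalIntegral.integral_sub
    intervalIntegrable_const hint, intervalIntegral.integral_const, smul_eq_mul] at hle
  linarith

theorem exists_isIntegralCurveOn_of_inner_le [FiniteDimensional ℝ X] {F : X → X}
    (hF : LocallyLipschitz F) {k : ℝ} (hk : ∀ x, ⟪F x, x⟫ ≤ k) (x₀ : X) {T : ℝ} (hT : 0 ≤ T) :
    ∃ x : ℝ → X, x 0 = x₀ ∧ IsIntegralCurveOn x (fun _ => F) (Icc 0 T) := by
  have hk₀ : 0 ≤ k := by simpa using hk 0
  set R := √(‖x₀‖ ^ 2 + 2 * k * T)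
  -- Truncating `F` outside the ball of radius `R + 1` preserves the bound `hk`, which confines the
  -- curves of the truncated field to the ball of radius `R`.
  let b : ContDiffBump (0 : X) := ⟨R + 1, R + 2, by positivity, by linarith⟩
  have hbF : LocallyLipschitz fun x => b x • F x :=
    (contDiff_smul (𝕜 := ℝ) (n := 1)).locallyLipschitz.comp
      (b.contDiff.locallyLipschitz.prodMk hF)
  obtain ⟨L, hL⟩ := (b.hasCompactSupport.smul_right (f' := F)).exists_bound_of_continuous
    hbF.continuous
  obtain ⟨x, hx₀, hx⟩ := exists_isIntegralCurveOn_of_bounded hbF hL x₀ hT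
  have hle (y : X) : ⟪b y • F y, y⟫ ≤ k := by
    rw [real_inner_smul_left]
    exact (mul_le_mul_of_nonneg_left (hk y) b.nonneg).trans (mul_le_of_le_one_left hk₀ b.le_one)
  have hbound : ∀ t ∈ Icc 0 T, ‖x t‖ ≤ R := by
    intro t ht
    have h := norm_sq_add_integral_le (d := 0) hx continuousOn_const
      (fun s _ => by simpa using hle (x s)) t ht
    refine Real.le_sqrt_of_sq_le ?_
    have := mul_le_mul_of_nonneg_left ht.2 (mul_nonneg zero_le_two hk₀)
    simp only [Pi.zero_apply, intervalIntegral.integral_zero, hx₀] at h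
    linarith
  refine ⟨x, hx₀, fun t ht => ?_⟩
  have hone : b (x t) = 1 := b.one_of_mem_closedBall
    (mem_closedBall_zero_iff.2 ((hbound t ht).trans (by linarith)))
  simpa only [hone, one_smul] using hx t ht

theorem hasDerivWithinAt_iff_inner [FiniteDimensional ℝ X] {x : ℝ → X} {x' : X} {J : Set ℝ}
    {t : ℝ} : HasDerivWithinAt x x' J t ↔
      ∀ b, HasDerivWithinAt (fun s => ⟪x s, b⟫) ⟪x', b⟫ J t := by
  refine ⟨fun h b => by simpa using h.inner ℝ (hasDerivWithinAt_const t J b), fun h => ?_⟩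
  let b := stdOrthonormalBasis ℝ X
  have hsum : HasDerivWithinAt (fun s => ∑ i, ⟪x s, b i⟫ • b i) (∑ i, ⟪x', b i⟫ • b i) J t :=
    .fun_sum fun i _ => (h (b i)).smul_const (b i)
  simpa only [real_inner_comm (b _), b.sum_repr'] using hsum

end IntegralCurves

section IntegralsOfBoundedMaps

variable {Ω M G : Type*} [MeasurableSpace Ω] {μ : Measure Ω} [NormedAddCommGroup M]
  [ProperSpace M] [NormedAddCommGroup G] {m : Ω → M}

lemma memLp_top_continuous_comp (hm : MemLp m ⊤ μ) {Ψ : M → G} (hΨ : Continuous Ψ) :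
    MemLp (fun y => Ψ (m y)) ⊤ μ := by
  obtain ⟨B, hB⟩ := (isCompact_closedBall (0 : M) (lpNorm m ⊤ μ)).exists_bound_of_continuousOn
    hΨ.continuousOn
  refine memLp_top_of_bound (hΨ.comp_aestronglyMeasurable hm.aestronglyMeasurable) B ?_
  filter_upwards [ae_le_lpNorm_exponent_top hm] with y hy using hB _ (mem_closedBall_zero_iff.2 hy)

variable [IsFiniteMeasure μ]

lemma integrable_continuous_comp (hm : MemLp m ⊤ μ) {Ψ : M → G} (hΨ : Continuous Ψ) :
    Integrable (fun y => Ψ (m y)) μ :=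
  (memLp_top_continuous_comp hm hΨ).integrable le_top

theorem locallyLipschitz_integral_comp [NormedSpace ℝ G] {X : Type*} [PseudoMetricSpace X]
    [ProperSpace X] (hm : MemLp m ⊤ μ) {Ψ : X × M → G} (hΨ : LocallyLipschitz Ψ) :
    LocallyLipschitz fun x => ∫ y, Ψ (x, m y) ∂μ := by
  intro x₀
  set s := Metric.closedBall x₀ 1 ×ˢ Metric.closedBall (0 : M) (lpNorm m ⊤ μ)
  obtain ⟨K, hK⟩ := hΨ.locallyLipschitzOn.exists_lipschitzOnWith_of_compact (s := s)
    ((isCompact_closedBall x₀ 1).prod (isCompact_closedBall 0 _))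
  have hint (x : X) : Integrable (fun y => Ψ (x, m y)) μ :=
    integrable_continuous_comp hm (hΨ.continuous.comp (.prodMk_right x))
  refine ⟨K * (μ.real univ).toNNReal, _, Metric.closedBall_mem_nhds x₀ one_pos,
    .of_dist_le_mul fun x hx x' hx' => ?_⟩
  have hdist : ∀ᵐ y ∂μ, ‖Ψ (x, m y) - Ψ (x', m y)‖ ≤ K * dist x x' := by
    filter_upwards [ae_le_lpNorm_exponent_top hm] with y hy
    have hy := mem_closedBall_zero_iff.2 hy
    simpa [dist_eq_norm, Prod.dist_eq] using hK.dist_le_mul (x, m y) ⟨hx, hy⟩ (x', m y) ⟨hx', hy⟩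
  rw [dist_eq_norm, ← integral_sub (hint x) (hint x')]
  refine (norm_integral_le_of_norm_le_const hdist).trans_eq ?_
  rw [NNReal.coe_mul, Real.coe_toNNReal _ measureReal_nonneg]
  ring

end IntegralsOfBoundedMaps

section RieszIntegral

variable {Ω H : Type*} [MeasurableSpace Ω] [NormedAddCommGroup H] [InnerProductSpace ℝ H]
  [CompleteSpace H] {μ : Measure Ω}

/-- The vector representing the functional `∫ y, ℓ y ∂μ`, for a field `ℓ` of functionals: the
right-hand side of an equation in weak form, seen as an element of the space of test vectors. -/
noncomputable def rieszIntegral (μ : Measure Ω) (ℓ : Ω → H →L[ℝ] ℝ) : H :=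
  (InnerProductSpace.toDual ℝ H).symm (∫ y, ℓ y ∂μ)

lemma inner_rieszIntegral {ℓ : Ω → H →L[ℝ] ℝ} (hℓ : Integrable ℓ μ) (c : H) :
    ⟪rieszIntegral μ ℓ, c⟫ = ∫ y, ℓ y c ∂μ := by
  rw [rieszIntegral, InnerProductSpace.toDual_symm_apply, ContinuousLinearMap.integral_apply hℓ]

end RieszIntegral

section GalerkinField

variable {Ω H E : Type*} [MeasurableSpace Ω] [NormedAddCommGroup H] [InnerProductSpace ℝ H]
  [NormedAddCommGroup E] [InnerProductSpace ℝ E]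

/-- The value and the gradient, at one point, of the function with coordinates `a : H`, as linear
functions of `a`. -/
abbrev Jet (H E : Type*) [NormedAddCommGroup H] [InnerProductSpace ℝ H] [NormedAddCommGroup E]
    [InnerProductSpace ℝ E] : Type _ := (H →L[ℝ] ℝ) × (H →L[ℝ] E)

/-- The form `ψ ↦ (η + φ(z)²) ∇u ⬝ ∇ψ` at a point with jet `j`, where `u` and `z` have coordinates
`a` and `b`. -/
noncomputable def diffusionForm (φ : ℝ → ℝ) (η : ℝ) (a b : H) (j : Jet H E) : H →L[ℝ] ℝ :=
  (η + φ (j.1 b) ^ 2) • innerSL ℝ (j.2 a) ∘L j.2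

/-- The form `ψ ↦ 2 ε ∇z ⬝ ∇ψ + φ'(z) φ(z) |∇u|² ψ - (1 - z) / (2 ε) ψ` at a point with jet `j`,
where `u` and `z` have coordinates `a` and `b`. -/
noncomputable def phaseForm (φ : ℝ → ℝ) (ε : ℝ) (a b : H) (j : Jet H E) : H →L[ℝ] ℝ :=
  (2 * ε) • innerSL ℝ (j.2 b) ∘L j.2 + (deriv φ (j.1 b) * φ (j.1 b) * ‖j.2 a‖ ^ 2) • j.1
    - ((1 - j.1 b) / (2 * ε)) • j.1

/-- The Dirichlet energy `∫ |∇u|²` of the function `u` with coordinates `a`. -/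
noncomputable def dirichletEnergy (μ : Measure Ω) (m : Ω → Jet H E) (a : H) : ℝ :=
  ∫ y, ‖(m y).2 a‖ ^ 2 ∂μ

variable {φ : ℝ → ℝ} {ε η : ℝ} {μ : Measure Ω} {m : Ω → Jet H E}

lemma diffusionForm_apply (a b c : H) (j : Jet H E) :
    diffusionForm φ η a b j c = (η + φ (j.1 b) ^ 2) * ⟪j.2 a, j.2 c⟫ := rfl

lemma phaseForm_apply (a b c : H) (j : Jet H E) :
    phaseForm φ ε a b j c = 2 * ε * ⟪j.2 b, j.2 c⟫ +
      deriv φ (j.1 b) * φ (j.1 b) * ‖j.2 a‖ ^ 2 * j.1 c - (1 - j.1 b) / (2 * ε) * j.1 c := rfl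

variable [FiniteDimensional ℝ H]

lemma contDiff_diffusionForm (hφ : ContDiff ℝ 1 φ) :
    ContDiff ℝ 1 fun p : (H × H) × Jet H E => diffusionForm φ η p.1.1 p.1.2 p.2 := by
  refine contDiff_clm_apply_iff.2 fun c => ?_
  simp only [diffusionForm_apply]
  have hz : ContDiff ℝ 1 fun p : (H × H) × Jet H E => p.2.1 p.1.2 := by fun_prop
  have hDu : ContDiff ℝ 1 fun p : (H × H) × Jet H E => p.2.2 p.1.1 := by fun_prop
  have hDψ : ContDiff ℝ 1 fun p : (H × H) × Jet H E => p.2.2 c := by fun_prop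
  exact (contDiff_const.add ((hφ.comp hz).pow 2)).mul (hDu.inner ℝ hDψ)

lemma contDiff_phaseForm (hφ : ContDiff ℝ 2 φ) :
    ContDiff ℝ 1 fun p : (H × H) × Jet H E => phaseForm φ ε p.1.1 p.1.2 p.2 := by
  refine contDiff_clm_apply_iff.2 fun c => ?_
  simp only [phaseForm_apply]
  have hφ' : ContDiff ℝ 1 (deriv φ) := hφ.deriv'
  have hφ₁ : ContDiff ℝ 1 φ := hφ.of_le one_le_two
  have hz : ContDiff ℝ 1 fun p : (H × H) × Jet H E => p.2.1 p.1.2 := by fun_prop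
  have hψ : ContDiff ℝ 1 fun p : (H × H) × Jet H E => p.2.1 c := by fun_prop
  have hDu : ContDiff ℝ 1 fun p : (H × H) × Jet H E => p.2.2 p.1.1 := by fun_prop
  have hDz : ContDiff ℝ 1 fun p : (H × H) × Jet H E => p.2.2 p.1.2 := by fun_prop
  have hDψ : ContDiff ℝ 1 fun p : (H × H) × Jet H E => p.2.2 c := by fun_prop
  exact ((contDiff_const.mul (hDz.inner ℝ hDψ)).add
    ((((hφ'.comp hz).mul (hφ₁.comp hz)).mul (hDu.norm_sq ℝ)).mul hψ)).sub
    (((contDiff_const.sub hz).div_const _).mul hψ)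

/-- The vector field of the Galerkin system in the `L²` coordinates `(a, b)` of `(u, z)`; `γ` is
the coordinate of the projection of `g`. The `ℓ²` product makes `‖u‖² + ‖z‖²` the squared norm of
`(a, b)`. -/
noncomputable def galerkinField (μ : Measure Ω) (m : Ω → Jet H E) (φ : ℝ → ℝ) (ε η : ℝ) (γ : H)
    (x : WithLp 2 (H × H)) : WithLp 2 (H × H) :=
  .toLp 2 (γ - x.fst - rieszIntegral μ fun y => diffusionForm φ η x.fst x.snd (m y),
    -rieszIntegral μ fun y => phaseForm φ ε x.fst x.snd (m y))

variable [IsFiniteMeasure μ] [FiniteDimensional ℝ E] {γ : H}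

lemma continuous_dirichletEnergy (hm : MemLp m ⊤ μ) : Continuous (dirichletEnergy μ m) := by
  have hDu : ContDiff ℝ 1 fun p : H × Jet H E => p.2.2 p.1 := by fun_prop
  exact (locallyLipschitz_integral_comp hm (hDu.norm_sq ℝ).locallyLipschitz).continuous

variable {G : H × H → Jet H E → H →L[ℝ] ℝ}

lemma integrable_form_comp (hm : MemLp m ⊤ μ)
    (hG : ContDiff ℝ 1 fun p : (H × H) × Jet H E => G p.1 p.2) (x : H × H) :
    Integrable (fun y => G x (m y)) μ :=
  integrable_continuous_comp hm (hG.continuous.comp (.prodMk_right x))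

lemma locallyLipschitz_rieszIntegral_comp (hm : MemLp m ⊤ μ)
    (hG : ContDiff ℝ 1 fun p : (H × H) × Jet H E => G p.1 p.2) :
    LocallyLipschitz fun x => rieszIntegral μ fun y => G x (m y) :=
  (InnerProductSpace.toDual ℝ H).symm.lipschitz.locallyLipschitz.comp
    (locallyLipschitz_integral_comp hm hG.locallyLipschitz)

theorem locallyLipschitz_galerkinField (hm : MemLp m ⊤ μ) (hφ : ContDiff ℝ 2 φ) :
    LocallyLipschitz (galerkinField μ m φ ε η γ) := by
  let L := WithLp.prodContinuousLinearEquiv 2 ℝ H H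
  have hu : LocallyLipschitz fun x : H × H =>
      γ - x.1 - rieszIntegral μ fun y => diffusionForm φ η x.1 x.2 (m y) :=
    ((LocallyLipschitz.const γ).sub LipschitzWith.prod_fst.locallyLipschitz).sub
      (locallyLipschitz_rieszIntegral_comp hm (contDiff_diffusionForm (hφ.of_le one_le_two)))
  have hz : LocallyLipschitz fun x : H × H =>
      -rieszIntegral μ fun y => phaseForm φ ε x.1 x.2 (m y) :=
    (locallyLipschitz_rieszIntegral_comp hm (contDiff_phaseForm hφ)).neg
  exact L.symm.lipschitz.locallyLipschitz.comp
    ((hu.prodMk hz).comp L.lipschitz.locallyLipschitz)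

lemma inner_galerkinField_fst (hm : MemLp m ⊤ μ) (hφ : ContDiff ℝ 1 φ) (x : WithLp 2 (H × H))
    (c : H) : ⟪(galerkinField μ m φ ε η γ x).fst, c⟫ =
      -(∫ y, (η + φ ((m y).1 x.snd) ^ 2) * ⟪(m y).2 x.fst, (m y).2 c⟫ ∂μ) - ⟪x.fst - γ, c⟫ := by
  have hint : Integrable (fun y => diffusionForm φ η x.fst x.snd (m y)) μ :=
    integrable_form_comp (G := fun x => diffusionForm φ η x.1 x.2) hm (contDiff_diffusionForm hφ)
      (x.fst, x.snd)
  change ⟪γ - x.fst - rieszIntegral μ _, c⟫ = _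
  simp only [inner_sub_left, inner_rieszIntegral hint, diffusionForm_apply]
  ring

lemma inner_galerkinField_snd (hm : MemLp m ⊤ μ) (hφ : ContDiff ℝ 2 φ) (x : WithLp 2 (H × H))
    (c : H) : ⟪(galerkinField μ m φ ε η γ x).snd, c⟫ =
      -(2 * ε * ∫ y, ⟪(m y).2 x.snd, (m y).2 c⟫ ∂μ)
        - (∫ y, deriv φ ((m y).1 x.snd) * φ ((m y).1 x.snd) * ‖(m y).2 x.fst‖ ^ 2 * (m y).1 c ∂μ)
        + ∫ y, (1 - (m y).1 x.snd) / (2 * ε) * (m y).1 c ∂μ := by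
  have hφ' : Continuous (deriv φ) := hφ.continuous_deriv one_le_two
  have hφ₀ : Continuous φ := hφ.continuous
  have hint : Integrable (fun y => phaseForm φ ε x.fst x.snd (m y)) μ :=
    integrable_form_comp (G := fun x => phaseForm φ ε x.1 x.2) hm (contDiff_phaseForm hφ)
      (x.fst, x.snd)
  have hint₁ : Integrable (fun y => ⟪(m y).2 x.snd, (m y).2 c⟫) μ :=
    integrable_continuous_comp hm (Ψ := fun j => ⟪j.2 x.snd, j.2 c⟫) (by fun_prop)
  have hint₂ : Integrable (fun y =>
      deriv φ ((m y).1 x.snd) * φ ((m y).1 x.snd) * ‖(m y).2 x.fst‖ ^ 2 * (m y).1 c) μ :=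
    integrable_continuous_comp hm
      (Ψ := fun j => deriv φ (j.1 x.snd) * φ (j.1 x.snd) * ‖j.2 x.fst‖ ^ 2 * j.1 c) (by fun_prop)
  have hint₃ : Integrable (fun y => (1 - (m y).1 x.snd) / (2 * ε) * (m y).1 c) μ :=
    integrable_continuous_comp hm (Ψ := fun j => (1 - j.1 x.snd) / (2 * ε) * j.1 c) (by fun_prop)
  change ⟪-rieszIntegral μ _, c⟫ = _
  simp only [inner_neg_left, inner_rieszIntegral hint, phaseForm_apply]
  rw [integral_sub ((hint₁.const_mul _).fun_add hint₂) hint₃,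
    integral_add (hint₁.const_mul _) hint₂, integral_const_mul]
  ring

lemma inner_galerkinField_fst_self_le (hm : MemLp m ⊤ μ) (hφ : ContDiff ℝ 1 φ)
    (x : WithLp 2 (H × H)) : ⟪(galerkinField μ m φ ε η γ x).fst, x.fst⟫ ≤
      ‖γ‖ ^ 2 / 2 - η * dirichletEnergy μ m x.fst := by
  have hdiff : η * dirichletEnergy μ m x.fst ≤
      ∫ y, (η + φ ((m y).1 x.snd) ^ 2) * ⟪(m y).2 x.fst, (m y).2 x.fst⟫ ∂μ := by
    have hφ₀ : Continuous φ := hφ.continuous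
    rw [dirichletEnergy, ← integral_const_mul]
    refine integral_mono
      (integrable_continuous_comp hm (Ψ := fun j => η * ‖j.2 x.fst‖ ^ 2) (by fun_prop))
      (integrable_continuous_comp hm
        (Ψ := fun j => (η + φ (j.1 x.snd) ^ 2) * ⟪j.2 x.fst, j.2 x.fst⟫) (by fun_prop))
      fun y => ?_
    simp only [real_inner_self_eq_norm_sq]
    gcongr
    exact le_add_of_nonneg_right (sq_nonneg _)
  have hdata : ‖x.fst - γ‖ ^ 2 = ‖γ‖ ^ 2 - ‖x.fst‖ ^ 2 + 2 * ⟪x.fst - γ, x.fst⟫ := by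
    rw [norm_sub_sq_real, inner_sub_left, real_inner_self_eq_norm_sq, real_inner_comm]
    ring
  rw [inner_galerkinField_fst hm hφ]
  linarith [sq_nonneg ‖x.fst‖, sq_nonneg ‖x.fst - γ‖]

lemma inner_galerkinField_snd_self_le (hm : MemLp m ⊤ μ) (hφ : ContDiff ℝ 2 φ)
    (hφs : ∀ s, 0 ≤ deriv φ s * φ s * s) (hε : 0 < ε) (x : WithLp 2 (H × H)) :
    ⟪(galerkinField μ m φ ε η γ x).snd, x.snd⟫ ≤
      μ.real univ / (8 * ε) - 2 * ε * dirichletEnergy μ m x.snd := by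
  have hcoupling : 0 ≤ ∫ y, deriv φ ((m y).1 x.snd) * φ ((m y).1 x.snd) * ‖(m y).2 x.fst‖ ^ 2 *
      (m y).1 x.snd ∂μ := by
    refine integral_nonneg fun y => ?_
    rw [Pi.zero_apply, mul_right_comm]
    exact mul_nonneg (hφs _) (sq_nonneg _)
  have hsource : ∫ y, (1 - (m y).1 x.snd) / (2 * ε) * (m y).1 x.snd ∂μ ≤
      μ.real univ / (8 * ε) := by
    have hle (s : ℝ) : (1 - s) / (2 * ε) * s ≤ 1 / (8 * ε) := by
      rw [div_mul_eq_mul_div, div_le_div_iff₀ (by positivity) (by positivity)]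
      nlinarith [sq_nonneg (2 * s - 1)]
    refine (integral_mono
      (integrable_continuous_comp hm (Ψ := fun j => (1 - j.1 x.snd) / (2 * ε) * j.1 x.snd)
        (by fun_prop))
      (integrable_const _) fun y => hle _).trans_eq ?_
    rw [integral_const, smul_eq_mul, mul_one_div]
  rw [inner_galerkinField_snd hm hφ]
  simp only [real_inner_self_eq_norm_sq, dirichletEnergy]
  linarith

end GalerkinField

section OrthonormalCoordinates

variable {Ω : Type*} [MeasurableSpace Ω] {μ : Measure Ω}

lemma inner_toLp {f g : Ω → ℝ} (hf : MemLp f 2 μ) (hg : MemLp g 2 μ) :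
    ⟪hf.toLp f, hg.toLp g⟫ = ∫ y, f y * g y ∂μ := by
  rw [L2.inner_def]
  refine integral_congr_ae ?_
  filter_upwards [hf.coeFn_toLp, hg.coeFn_toLp] with y hfy hgy
  rw [hfy, hgy, real_inner_eq_re_inner, RCLike.inner_apply, mul_comm]
  simp

lemma exists_linearMap_inner_eq_integral (V : Submodule ℝ (Ω → ℝ)) [FiniteDimensional ℝ V]
    (hV : ∀ v ∈ V, MemLp v 2 μ) :
    ∃ (n : ℕ) (s : EuclideanSpace ℝ (Fin n) →ₗ[ℝ] V),
      (∀ a b, ⟪a, b⟫ = ∫ y, (s a : Ω → ℝ) y * (s b : Ω → ℝ) y ∂μ) ∧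
      ∀ v : V, ∃ a, (s a : Ω → ℝ) =ᵐ[μ] v := by
  let Λ : V →ₗ[ℝ] Lp ℝ 2 μ :=
    { toFun := fun v => (hV v v.2).toLp v, map_add' := fun _ _ => rfl, map_smul' := fun _ _ => rfl }
  obtain ⟨σ, hσ⟩ := Λ.rangeRestrict.exists_rightInverse_of_surjective Λ.range_rangeRestrict
  let ψ := (stdOrthonormalBasis ℝ (LinearMap.range Λ)).repr
  have hΛσ (w : LinearMap.range Λ) : Λ (σ w) = w :=
    congrArg Subtype.val (LinearMap.congr_fun hσ w)
  refine ⟨_, σ ∘ₗ ψ.symm.toLinearEquiv, fun a b => ?_, fun v => ⟨ψ (Λ.rangeRestrict v), ?_⟩⟩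
  · rw [← ψ.symm.inner_map_map, Submodule.coe_inner, ← hΛσ, ← hΛσ (ψ.symm b)]
    exact inner_toLp (hV _ (Subtype.prop _)) (hV _ (Subtype.prop _))
  · refine ((hV _ (Subtype.prop _)).toLp_eq_toLp_iff (hV v v.2)).1 ?_
    change Λ (σ (ψ.symm (ψ (Λ.rangeRestrict v)))) = Λ v
    rw [ψ.symm_apply_apply]
    exact hΛσ _

end OrthonormalCoordinates

section BoundedC1

variable {E F G : Type*} [NormedAddCommGroup E] [NormedSpace ℝ E] [NormedAddCommGroup F]
  [NormedSpace ℝ F] [NormedAddCommGroup G] [NormedSpace ℝ G] {U : Set E}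

/-- `v ∈ C¹(U)` is bounded and has a bounded derivative on `U`. -/
structure IsBoundedC1On (v : E → F) (U : Set E) : Prop where
  contDiffOn : ContDiffOn ℝ 1 v U
  bounded : ∃ C, ∀ y ∈ U, ‖v y‖ ≤ C
  bounded_fderiv : ∃ C, ∀ y ∈ U, ‖fderiv ℝ v y‖ ≤ C

namespace IsBoundedC1On

variable {v w : E → F}

lemma differentiableAt (hv : IsBoundedC1On v U) (hU : IsOpen U) {y : E} (hy : y ∈ U) :
    DifferentiableAt ℝ v y :=
  (hv.contDiffOn.differentiableOn one_ne_zero).differentiableAt (hU.mem_nhds hy)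

lemma zero : IsBoundedC1On (0 : E → F) U :=
  ⟨contDiffOn_const, ⟨0, by simp⟩, ⟨0, by simp⟩⟩

lemma add (hU : IsOpen U) (hv : IsBoundedC1On v U) (hw : IsBoundedC1On w U) :
    IsBoundedC1On (v + w) U := by
  obtain ⟨C, hC⟩ := hv.bounded
  obtain ⟨D, hD⟩ := hw.bounded
  obtain ⟨C', hC'⟩ := hv.bounded_fderiv
  obtain ⟨D', hD'⟩ := hw.bounded_fderiv
  refine ⟨hv.contDiffOn.add hw.contDiffOn,
    ⟨C + D, fun y hy => norm_add_le_of_le (hC y hy) (hD y hy)⟩, ⟨C' + D', fun y hy => ?_⟩⟩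
  rw [fderiv_add (hv.differentiableAt hU hy) (hw.differentiableAt hU hy)]
  exact norm_add_le_of_le (hC' y hy) (hD' y hy)

lemma continuousLinearMap_comp (hU : IsOpen U) (hv : IsBoundedC1On v U) (L : F →L[ℝ] G) :
    IsBoundedC1On (L ∘ v) U := by
  obtain ⟨C, hC⟩ := hv.bounded
  obtain ⟨C', hC'⟩ := hv.bounded_fderiv
  refine ⟨L.contDiff.comp_contDiffOn hv.contDiffOn,
    ⟨‖L‖ * C, fun y hy => L.le_opNorm_of_le (hC y hy)⟩, ⟨‖L‖ * C', fun y hy => ?_⟩⟩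
  rw [fderiv_comp y L.differentiableAt (hv.differentiableAt hU hy), L.fderiv]
  exact (L.opNorm_comp_le _).trans (mul_le_mul_of_nonneg_left (hC' y hy) (norm_nonneg L))

lemma of_mem_span (hU : IsOpen U) {s : Set (E → F)} (hs : ∀ v ∈ s, IsBoundedC1On v U)
    (hv : v ∈ Submodule.span ℝ s) : IsBoundedC1On v U := by
  induction hv using Submodule.span_induction with
  | mem v hv => exact hs v hv
  | zero => exact zero
  | add v w _ _ hv hw => exact hv.add hU hw
  | smul c v _ hv => exact hv.continuousLinearMap_comp hU (c • ContinuousLinearMap.id ℝ F)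

lemma sum_smul_const (hU : IsOpen U) {ι : Type*} [Fintype ι] {f : ι → E → ℝ}
    (hf : ∀ i, IsBoundedC1On (f i) U) (b : ι → F) :
    IsBoundedC1On (∑ i, fun y => f i y • b i) U :=
  Finset.sum_induction _ (IsBoundedC1On · U) (fun _ _ => add hU) zero fun i _ =>
    (hf i).continuousLinearMap_comp hU (ContinuousLinearMap.smulRight (.id ℝ ℝ) (b i))

lemma memLp_top [MeasurableSpace E] [OpensMeasurableSpace E] [SecondCountableTopology E]
    {μ : Measure E} (hU : IsOpen U) (hv : IsBoundedC1On v U) : MemLp v ⊤ (μ.restrict U) := by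
  obtain ⟨C, hC⟩ := hv.bounded
  exact memLp_top_of_bound
    (hv.contDiffOn.continuousOn.aestronglyMeasurable hU.measurableSet) C
    (ae_restrict_of_forall_mem hU.measurableSet hC)

end IsBoundedC1On

end BoundedC1

section Charts

variable {E H : Type*} [NormedAddCommGroup E] [InnerProductSpace ℝ E] [NormedAddCommGroup H]
  [InnerProductSpace ℝ H] [MeasurableSpace E] {μ : Measure E} {U : Set E}

/-- The function with coordinate `a` with respect to the reproducing kernel map `k`. -/
def ofCoord (k : E → H) (a : H) (y : E) : ℝ := ⟪k y, a⟫

/-- The coordinate of the `L²(ν)` projection of `f` on the functions `ofCoord k a`. -/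
noncomputable def coord (ν : Measure E) (k : E → H) (f : E → ℝ) : H :=
  ∫ y, f y • k y ∂ν

/-- The jet at `y` of `a ↦ ofCoord k a`. -/
noncomputable def jet [CompleteSpace E] [CompleteSpace H] (k : E → H) (y : E) : Jet H E :=
  (innerSL ℝ (k y), ContinuousLinearMap.adjoint (fderiv ℝ k y))

/-- `k` is a reproducing kernel map of the space `V` of functions on `U`: up to values outside `U`,
`a ↦ ofCoord k a` is an isometry of `H` onto `V` with the inner product of `L²(U)`. -/
structure IsL2Chart (μ : Measure E) (U : Set E) (V : Submodule ℝ (E → ℝ)) (k : E → H) : Prop where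
  isBoundedC1On : IsBoundedC1On k U
  inner_eq : ∀ a b, ⟪a, b⟫ = ∫ y in U, ofCoord k a y * ofCoord k b y ∂μ
  mem : ∀ a, ofCoord k a ∈ V
  exists_eqOn : ∀ v ∈ V, ∃ a, EqOn v (ofCoord k a) U

theorem exists_isL2Chart [BorelSpace E] [SecondCountableTopology E] [μ.IsOpenPosMeasure]
    [IsFiniteMeasure (μ.restrict U)] (hU : IsOpen U) (V : Submodule ℝ (E → ℝ))
    [FiniteDimensional ℝ V] (hV : ∀ v ∈ V, IsBoundedC1On v U) :
    ∃ (n : ℕ) (k : E → EuclideanSpace ℝ (Fin n)), IsL2Chart μ U V k := by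
  have hV₂ : ∀ v ∈ V, MemLp v 2 (μ.restrict U) := fun v hv =>
    ((hV v hv).memLp_top hU).mono_exponent le_top
  obtain ⟨n, s, hinner, hsurj⟩ := exists_linearMap_inner_eq_integral V hV₂
  let b := EuclideanSpace.basisFun (Fin n) ℝ
  let k : E → EuclideanSpace ℝ (Fin n) := ∑ i, fun y => (s (b i) : E → ℝ) y • b i
  have hk (a) : ofCoord k a = s a := by
    ext y
    conv_rhs => rw [← b.sum_repr' a]
    simp [ofCoord, k, sum_inner, inner_smul_left, mul_comm]
  refine ⟨n, k, .sum_smul_const hU (fun i => hV _ (s (b i)).2) b, fun a b => ?_, fun a => ?_,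
    fun v hv => ?_⟩
  · simp only [hinner, hk]
  · rw [hk]
    exact (s a).2
  · obtain ⟨a, ha⟩ := hsurj ⟨v, hv⟩
    refine ⟨a, ?_⟩
    rw [hk]
    exact Measure.eqOn_open_of_ae_eq ha.symm hU (hV v hv).contDiffOn.continuousOn
      (hV _ (s a).2).contDiffOn.continuousOn

namespace IsL2Chart

variable {V : Submodule ℝ (E → ℝ)} {k : E → H} {f v : E → ℝ} {a : H}

lemma gradient_eq [CompleteSpace E] [CompleteSpace H] (hk : IsL2Chart μ U V k) (hU : IsOpen U)
    (hv : EqOn v (ofCoord k a) U) {y : E} (hy : y ∈ U) : ∇ v y = (jet k y).2 a := by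
  rw [(hv.eventuallyEq_of_mem (hU.mem_nhds hy)).gradient_eq]
  refine HasGradientAt.gradient (hasGradientAt_iff_hasFDerivAt.2 ?_)
  refine (((hk.isBoundedC1On.differentiableAt hU hy).hasFDerivAt.inner ℝ
    (hasFDerivAt_const a y))).congr_fderiv ?_
  ext z
  simp [jet, ContinuousLinearMap.adjoint_inner_left, real_inner_comm]

variable [BorelSpace E]

lemma integral_sq_eq (hk : IsL2Chart μ U V k) (hU : IsOpen U) (hv : EqOn v (ofCoord k a) U) :
    ∫ y in U, v y ^ 2 ∂μ = ‖a‖ ^ 2 := by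
  rw [← real_inner_self_eq_norm_sq, hk.inner_eq]
  exact setIntegral_congr_fun hU.measurableSet fun y hy => by simp only [hv hy, sq]

variable [SecondCountableTopology E]

lemma memLp_top_jet [CompleteSpace E] [CompleteSpace H] (hk : IsL2Chart μ U V k)
    (hU : IsOpen U) : MemLp (jet k) ⊤ (μ.restrict U) := by
  obtain ⟨C, hC⟩ := hk.isBoundedC1On.bounded
  obtain ⟨C', hC'⟩ := hk.isBoundedC1On.bounded_fderiv
  have hcont : ContinuousOn (jet k) U :=
    ((innerSL ℝ).continuous.comp_continuousOn hk.isBoundedC1On.contDiffOn.continuousOn).prodMk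
      (ContinuousLinearMap.adjoint.continuous.comp_continuousOn
        (hk.isBoundedC1On.contDiffOn.continuousOn_fderiv_of_isOpen hU le_rfl))
  refine memLp_top_of_bound (hcont.aestronglyMeasurable hU.measurableSet) (max C C')
    (ae_restrict_of_forall_mem hU.measurableSet fun y hy => max_le_max ?_ ?_)
  · exact (innerSL_apply_norm ℝ (k y)).trans_le (hC y hy)
  · exact (LinearIsometryEquiv.norm_map _ _).trans_le (hC' y hy)

variable [IsFiniteMeasure (μ.restrict U)]

lemma memLp_two (hk : IsL2Chart μ U V k) (hU : IsOpen U) (hv : EqOn v (ofCoord k a) U) :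
    MemLp v 2 (μ.restrict U) := by
  have hae : innerSL ℝ a ∘ k =ᵐ[μ.restrict U] v := by
    refine ae_restrict_of_forall_mem hU.measurableSet fun y hy => ?_
    rw [hv hy, ofCoord, real_inner_comm]
    rfl
  exact (memLp_congr_ae hae).1
    (((hk.isBoundedC1On.continuousLinearMap_comp hU (innerSL ℝ a)).memLp_top hU).mono_exponent
      le_top)

lemma inner_coord [CompleteSpace H] (hk : IsL2Chart μ U V k) (hU : IsOpen U)
    (hf : MemLp f 2 (μ.restrict U)) (b : H) :
    ⟪coord (μ.restrict U) k f, b⟫ = ∫ y in U, f y * ofCoord k b y ∂μ := by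
  have hint : Integrable (fun y => f y • k y) (μ.restrict U) :=
    (hf.integrable one_le_two).smul_of_top_left (hk.isBoundedC1On.memLp_top hU)
  rw [coord, real_inner_comm, ← integral_inner hint]
  simp only [ofCoord, inner_smul_right, real_inner_comm]

lemma norm_coord_sq_le [CompleteSpace H] (hk : IsL2Chart μ U V k) (hU : IsOpen U)
    (hf : MemLp f 2 (μ.restrict U)) :
    ‖coord (μ.restrict U) k f‖ ^ 2 ≤ ∫ y in U, f y ^ 2 ∂μ := by
  set c := coord (μ.restrict U) k f with hc
  have hle : ∫ y in U, f y * ofCoord k c y ∂μ ≤ ∫ y in U, (f y ^ 2 + ofCoord k c y ^ 2) / 2 ∂μ :=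
    integral_mono (hf.integrable_mul (hk.memLp_two hU (eqOn_refl _ _)))
      ((hf.integrable_sq.add (hk.memLp_two hU (eqOn_refl _ _)).integrable_sq).div_const 2)
      fun y => by dsimp only; linarith [two_mul_le_add_sq (f y) (ofCoord k c y)]
  rw [integral_div, integral_add hf.integrable_sq (hk.memLp_two hU (eqOn_refl _ _)).integrable_sq,
    hk.integral_sq_eq hU (eqOn_refl _ _), ← hk.inner_coord hU hf, ← hc,
    real_inner_self_eq_norm_sq] at hle
  linarith

end IsL2Chart

end Charts

section EnergyBounds

variable {U : Set Plane} {I J : Set ℝ} {u v : ℝ → Plane → ℝ} {C D : ℝ}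

lemma EnergyBound.mono_set (h : EnergyBound U J u C) (hIJ : I ⊆ J) : EnergyBound U I u C := by
  obtain ⟨hbdd, hint, hle⟩ := h
  have hsup : (⨆ t : I, ∫ x in U, u t x ^ 2) ≤ ⨆ t : J, ∫ x in U, u t x ^ 2 :=
    Real.iSup_le (fun t => le_ciSup hbdd ⟨t, hIJ t.2⟩)
      (Real.iSup_nonneg fun t => integral_nonneg fun x => sq_nonneg _)
  refine ⟨hbdd.mono (range_subset_range_iff_exists_comp.2 ⟨inclusion hIJ, rfl⟩), hint.mono_set hIJ,
    (add_le_add hsup (setIntegral_mono_set hint ?_ hIJ.eventuallyLE)).trans hle⟩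
  exact ae_of_all _ fun s => integral_nonneg fun x => sq_nonneg _

lemma EnergyBound.mono (h : EnergyBound U J u C) (hCD : C ≤ D) : EnergyBound U J u D :=
  ⟨h.1, h.2.1, h.2.2.trans hCD⟩

lemma EnergyBound.congr (hU : IsOpen U) (hJ : MeasurableSet J) (h : EnergyBound U J u C)
    (huv : ∀ t ∈ J, EqOn (u t) (v t) U) : EnergyBound U J v C := by
  have hsq : ∀ t ∈ J, ∫ x in U, u t x ^ 2 = ∫ x in U, v t x ^ 2 := fun t ht =>
    setIntegral_congr_fun hU.measurableSet fun x hx => by simp only [huv t ht hx]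
  have hgrad : EqOn (fun s => ∫ x in U, ‖gradient (u s) x‖ ^ 2)
      (fun s => ∫ x in U, ‖gradient (v s) x‖ ^ 2) J := fun t ht =>
    setIntegral_congr_fun hU.measurableSet fun x hx => by
      simp only [((huv t ht).eventuallyEq_of_mem (hU.mem_nhds hx)).gradient_eq]
  obtain ⟨hbdd, hint, hle⟩ := h
  simp only [fun t : J => hsq t t.2] at hbdd hle
  rw [setIntegral_congr_fun hJ hgrad] at hle
  exact ⟨hbdd, (integrableOn_congr_fun hgrad hJ).1 hint, hle⟩

end EnergyBounds

section GalerkinSolutions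

variable {U : Set Plane} {V : Submodule ℝ (Plane → ℝ)} {H : Type*} [NormedAddCommGroup H]
  [InnerProductSpace ℝ H] {k : Plane → H} {J : Set ℝ}

/-- The curve `u` in `V` has coordinates `a` on the time set `J`. -/
structure HasCoords (U : Set Plane) (V : Submodule ℝ (Plane → ℝ)) (k : Plane → H) (J : Set ℝ)
    (u : ℝ → Plane → ℝ) (a : ℝ → H) : Prop where
  mem : ∀ t ∈ J, u t ∈ V
  eqOn : ∀ t ∈ J, EqOn (u t) (ofCoord k (a t)) U

lemma IsL2Chart.exists_hasCoords (hk : IsL2Chart volume U V k) {u : ℝ → Plane → ℝ}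
    (hu : ∀ t ∈ J, u t ∈ V) : ∃ a, HasCoords U V k J u a := by
  choose! a ha using fun t ht => hk.exists_eqOn (u t) (hu t ht)
  exact ⟨a, hu, ha⟩

lemma IsL2Chart.hasCoords_ofCoord (hk : IsL2Chart volume U V k) (a : ℝ → H) :
    HasCoords U V k J (fun t => ofCoord k (a t)) a :=
  ⟨fun _ _ => hk.mem _, fun _ _ => eqOn_refl _ _⟩

lemma IsL2Chart.integral_mul_eq (hk : IsL2Chart volume U V k) (hU : IsOpen U)
    {v w : Plane → ℝ} {a b : H} (hv : EqOn v (ofCoord k a) U) (hw : EqOn w (ofCoord k b) U) :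
    ∫ x in U, v x * w x = ⟪a, b⟫ := by
  rw [hk.inner_eq]
  exact setIntegral_congr_fun hU.measurableSet fun x hx => by simp only [hv hx, hw hx]

variable [IsFiniteMeasure (volume.restrict U)]

lemma IsL2Chart.isL2Projection_iff [CompleteSpace H] (hk : IsL2Chart volume U V k) (hU : IsOpen U)
    {f v : Plane → ℝ} {a : H} (hf : MemLp f 2 (volume.restrict U)) (hv : v ∈ V)
    (ha : EqOn v (ofCoord k a) U) :
    IsL2Projection U V f v ↔ a = coord (volume.restrict U) k f := by
  have htest {ψ : Plane → ℝ} {b : H} (hb : EqOn ψ (ofCoord k b) U) :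
      ∫ x in U, (f x - v x) * ψ x = ⟪coord (volume.restrict U) k f - a, b⟫ := by
    have hψ := hk.memLp_two hU hb
    simp only [sub_mul]
    have hfψ : Integrable (fun x => f x * ψ x) (volume.restrict U) := hf.integrable_mul hψ
    have hvψ : Integrable (fun x => v x * ψ x) (volume.restrict U) :=
      (hk.memLp_two hU ha).integrable_mul hψ
    have hcoord : ∫ x in U, f x * ψ x = ⟪coord (volume.restrict U) k f, b⟫ := by
      rw [hk.inner_coord hU hf]
      exact setIntegral_congr_fun hU.measurableSet fun x hx => by simp only [hb hx]
    rw [integral_sub hfψ hvψ, hcoord, hk.integral_mul_eq hU ha hb, inner_sub_left]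
  refine ⟨fun h => ext_inner_right ℝ fun b => ?_, fun h => ⟨hv, fun ψ hψ => ?_⟩⟩
  · have := h.2 _ (hk.mem b)
    rw [htest (eqOn_refl _ _), inner_sub_left] at this
    linarith
  · obtain ⟨b, hb⟩ := hk.exists_eqOn ψ hψ
    rw [htest hb, ← h, sub_self, inner_zero_left]

variable [FiniteDimensional ℝ H] {φ : ℝ → ℝ} {ε η : ℝ} {u z : ℝ → Plane → ℝ}
  {x : ℝ → WithLp 2 (H × H)} {gN ψ : Plane → ℝ} {γ b : H} {t : ℝ}

lemma hasDerivWithinAt_diffusion_iff (hk : IsL2Chart volume U V k) (hU : IsOpen U)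
    (hφ : ContDiff ℝ 1 φ) (hu : HasCoords U V k J u fun t => (x t).fst)
    (hz : HasCoords U V k J z fun t => (x t).snd) (hg : EqOn gN (ofCoord k γ) U)
    (hψ : EqOn ψ (ofCoord k b) U) (ht : t ∈ J) :
    HasDerivWithinAt (fun s => ∫ x in U, u s x * ψ x)
        (-(∫ x in U, (η + φ (z t x) ^ 2) * inner ℝ (gradient (u t) x) (gradient ψ x))
          - ∫ x in U, (u t x - gN x) * ψ x) J t ↔
      HasDerivWithinAt (fun s => ⟪(x s).fst, b⟫)
        ⟪(galerkinField (volume.restrict U) (jet k) φ ε η γ (x t)).fst, b⟫ J t := by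
  have hval : ∀ s ∈ J, ∫ x in U, u s x * ψ x = ⟪(x s).fst, b⟫ := fun s hs =>
    hk.integral_mul_eq hU (hu.eqOn s hs) hψ
  have hzt {y : Plane} (hy : y ∈ U) : z t y = (jet k y).1 (x t).snd := hz.eqOn t ht hy
  have hdiffusion : ∫ y in U, (η + φ (z t y) ^ 2) * inner ℝ (gradient (u t) y) (gradient ψ y) =
      ∫ y in U, (η + φ ((jet k y).1 (x t).snd) ^ 2) * ⟪(jet k y).2 (x t).fst, (jet k y).2 b⟫ :=
    setIntegral_congr_fun hU.measurableSet fun y hy => by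
      simp only [hzt hy, hk.gradient_eq hU (hu.eqOn t ht) hy, hk.gradient_eq hU hψ hy]
  have hsub : EqOn (fun y => u t y - gN y) (ofCoord k ((x t).fst - γ)) U := fun y hy => by
    simp only [hu.eqOn t ht hy, hg hy, ofCoord, inner_sub_right]
  rw [inner_galerkinField_fst (hk.memLp_top_jet hU) hφ, hdiffusion,
    hk.integral_mul_eq hU hsub hψ]
  exact ⟨fun h => h.congr (fun s hs => (hval s hs).symm) (hval t ht).symm,
    fun h => h.congr hval (hval t ht)⟩

lemma hasDerivWithinAt_phase_iff (hk : IsL2Chart volume U V k) (hU : IsOpen U)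
    (hφ : ContDiff ℝ 2 φ) (hu : HasCoords U V k J u fun t => (x t).fst)
    (hz : HasCoords U V k J z fun t => (x t).snd) (hψ : EqOn ψ (ofCoord k b) U) (ht : t ∈ J) :
    HasDerivWithinAt (fun s => ∫ x in U, z s x * ψ x)
        (-(2 * ε * ∫ x in U, inner ℝ (gradient (z t) x) (gradient ψ x))
          - (∫ x in U, deriv φ (z t x) * φ (z t x) * ‖gradient (u t) x‖ ^ 2 * ψ x)
          + ∫ x in U, (1 - z t x) / (2 * ε) * ψ x) J t ↔
      HasDerivWithinAt (fun s => ⟪(x s).snd, b⟫)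
        ⟪(galerkinField (volume.restrict U) (jet k) φ ε η γ (x t)).snd, b⟫ J t := by
  have hval : ∀ s ∈ J, ∫ x in U, z s x * ψ x = ⟪(x s).snd, b⟫ := fun s hs =>
    hk.integral_mul_eq hU (hz.eqOn s hs) hψ
  have hzt {y : Plane} (hy : y ∈ U) : z t y = (jet k y).1 (x t).snd := hz.eqOn t ht hy
  have hψy {y : Plane} (hy : y ∈ U) : ψ y = (jet k y).1 b := hψ hy
  have hDu {y : Plane} (hy : y ∈ U) := hk.gradient_eq hU (hu.eqOn t ht) hy
  have hDz {y : Plane} (hy : y ∈ U) := hk.gradient_eq hU (hz.eqOn t ht) hy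
  have hDψ {y : Plane} (hy : y ∈ U) := hk.gradient_eq hU hψ hy
  have hdiffusion : ∫ y in U, inner ℝ (gradient (z t) y) (gradient ψ y) =
      ∫ y in U, ⟪(jet k y).2 (x t).snd, (jet k y).2 b⟫ :=
    setIntegral_congr_fun hU.measurableSet fun y hy => by simp only [hDz hy, hDψ hy]
  have hcoupling : ∫ y in U, deriv φ (z t y) * φ (z t y) * ‖gradient (u t) y‖ ^ 2 * ψ y =
      ∫ y in U, deriv φ ((jet k y).1 (x t).snd) * φ ((jet k y).1 (x t).snd) *
        ‖(jet k y).2 (x t).fst‖ ^ 2 * (jet k y).1 b :=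
    setIntegral_congr_fun hU.measurableSet fun y hy => by simp only [hzt hy, hDu hy, hψy hy]
  have hsource : ∫ y in U, (1 - z t y) / (2 * ε) * ψ y =
      ∫ y in U, (1 - (jet k y).1 (x t).snd) / (2 * ε) * (jet k y).1 b :=
    setIntegral_congr_fun hU.measurableSet fun y hy => by simp only [hzt hy, hψy hy]
  rw [inner_galerkinField_snd (hk.memLp_top_jet hU) hφ, hdiffusion, hcoupling, hsource]
  exact ⟨fun h => h.congr (fun s hs => (hval s hs).symm) (hval t ht).symm,
    fun h => h.congr hval (hval t ht)⟩

variable {e : ℕ → Plane → ℝ} {N : ℕ} {g u₀ z₀ : Plane → ℝ} {T : ℝ}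

lemma isGalerkinSolution_iff (hk : IsL2Chart volume U (galerkinSpace e N) k) (hU : IsOpen U)
    (hφ : ContDiff ℝ 2 φ) (hg : MemLp g 2 (volume.restrict U))
    (hu₀ : MemLp u₀ 2 (volume.restrict U)) (hz₀ : MemLp z₀ 2 (volume.restrict U)) (hJ : 0 ∈ J)
    (hu : HasCoords U (galerkinSpace e N) k J u fun t => (x t).fst)
    (hz : HasCoords U (galerkinSpace e N) k J z fun t => (x t).snd) :
    IsGalerkinSolution U φ ε η g u₀ z₀ e N J u z ↔
      x 0 = .toLp 2 (coord (volume.restrict U) k u₀, coord (volume.restrict U) k z₀) ∧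
      IsIntegralCurveOn x (fun _ => galerkinField (volume.restrict U) (jet k) φ ε η
        (coord (volume.restrict U) k g)) J := by
  have hφ₁ : ContDiff ℝ 1 φ := hφ.of_le one_le_two
  have hinit_u := hk.isL2Projection_iff hU hu₀ (hu.mem 0 hJ) (hu.eqOn 0 hJ)
  have hinit_z := hk.isL2Projection_iff hU hz₀ (hz.mem 0 hJ) (hz.eqOn 0 hJ)
  constructor
  · rintro ⟨-, -, hu0, hz0, ⟨gN, hgN, hequ⟩, heqz⟩
    obtain ⟨γ, hγ⟩ := hk.exists_eqOn gN hgN.1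
    obtain rfl := (hk.isL2Projection_iff hU hg hgN.1 hγ).1 hgN
    refine ⟨congrArg (WithLp.toLp 2) (Prod.ext (hinit_u.1 hu0) (hinit_z.1 hz0)), fun t ht => ?_⟩
    refine hasDerivWithinAt_withLp_prod_iff.2 ⟨hasDerivWithinAt_iff_inner.2 fun b => ?_,
      hasDerivWithinAt_iff_inner.2 fun b => ?_⟩
    · exact (hasDerivWithinAt_diffusion_iff hk hU hφ₁ hu hz hγ (eqOn_refl _ _) ht).1
        (hequ t ht _ (hk.mem b))
    · exact (hasDerivWithinAt_phase_iff hk hU hφ hu hz (eqOn_refl _ _) ht).1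
        (heqz t ht _ (hk.mem b))
  · rintro ⟨hx0, hx⟩
    refine ⟨hu.mem, hz.mem, hinit_u.2 (congrArg WithLp.fst hx0),
      hinit_z.2 (congrArg WithLp.snd hx0), ⟨ofCoord k (coord (volume.restrict U) k g),
      (hk.isL2Projection_iff hU hg (hk.mem _) (eqOn_refl _ _)).2 rfl, fun t ht ψ hψ => ?_⟩,
      fun t ht ψ hψ => ?_⟩
    all_goals obtain ⟨b, hb⟩ := hk.exists_eqOn ψ hψ
    · exact (hasDerivWithinAt_diffusion_iff hk hU hφ₁ hu hz (eqOn_refl _ _) hb ht).2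
        (hasDerivWithinAt_iff_inner.1 (hasDerivWithinAt_withLp_prod_iff.1 (hx t ht)).1 b)
    · exact (hasDerivWithinAt_phase_iff hk hU hφ hu hz hb ht).2
        (hasDerivWithinAt_iff_inner.1 (hasDerivWithinAt_withLp_prod_iff.1 (hx t ht)).2 b)

lemma IsGalerkinSolution.exists_isIntegralCurveOn
    (h : IsGalerkinSolution U φ ε η g u₀ z₀ e N J u z)
    (hk : IsL2Chart volume U (galerkinSpace e N) k) (hU : IsOpen U)
    (hφ : ContDiff ℝ 2 φ) (hg : MemLp g 2 (volume.restrict U))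
    (hu₀ : MemLp u₀ 2 (volume.restrict U)) (hz₀ : MemLp z₀ 2 (volume.restrict U)) (hJ : 0 ∈ J) :
    ∃ x : ℝ → WithLp 2 (H × H), HasCoords U (galerkinSpace e N) k J u (fun t => (x t).fst) ∧
      HasCoords U (galerkinSpace e N) k J z (fun t => (x t).snd) ∧
      x 0 = .toLp 2 (coord (volume.restrict U) k u₀, coord (volume.restrict U) k z₀) ∧
      IsIntegralCurveOn x (fun _ => galerkinField (volume.restrict U) (jet k) φ ε η
        (coord (volume.restrict U) k g)) J := by
  obtain ⟨a, ha⟩ := hk.exists_hasCoords h.mem_u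
  obtain ⟨b, hb⟩ := hk.exists_hasCoords h.mem_z
  let x : ℝ → WithLp 2 (H × H) := fun t => .toLp 2 (a t, b t)
  exact ⟨x, ha, hb, (isGalerkinSolution_iff (x := x) hk hU hφ hg hu₀ hz₀ hJ ha hb).1 h⟩

lemma energyBound_of_inner_le {a a' : ℝ → H} {c κ A : ℝ} (hk : IsL2Chart volume U V k)
    (hU : IsOpen U) (hu : HasCoords U V k (Icc 0 T) u a)
    (ha : ∀ t ∈ Icc 0 T, HasDerivWithinAt a (a' t) (Icc 0 T) t) (hc : 0 < c) (hκ : 0 ≤ κ)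
    (hT : 0 ≤ T) (h : ∀ t ∈ Icc 0 T,
      ⟪a' t, a t⟫ ≤ κ - c * dirichletEnergy (volume.restrict U) (jet k) (a t))
    (hA : ‖a 0‖ ^ 2 + 2 * κ * T ≤ A) : EnergyBound U (Icc 0 T) u (A + A / (2 * c)) := by
  set D := fun t => dirichletEnergy (volume.restrict U) (jet k) (a t)
  have hD_nonneg (t : ℝ) : 0 ≤ D t := integral_nonneg fun y => sq_nonneg _
  have hD_cont : ContinuousOn D (Icc 0 T) :=
    (continuous_dirichletEnergy (hk.memLp_top_jet hU)).comp_continuousOn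
      fun t ht => (ha t ht).continuousWithinAt
  have hu_sq (t : Icc 0 T) : ∫ y in U, u t y ^ 2 = ‖a t‖ ^ 2 :=
    hk.integral_sq_eq hU (hu.eqOn t t.2)
  have hu_grad : EqOn D (fun t => ∫ y in U, ‖gradient (u t) y‖ ^ 2) (Icc 0 T) := fun t ht =>
    setIntegral_congr_fun hU.measurableSet fun y hy => by
      simp only [hk.gradient_eq hU (hu.eqOn t ht) hy]
  have henergy : ∀ t ∈ Icc 0 T, ‖a t‖ ^ 2 + 2 * (c * ∫ s in 0..t, D s) ≤ A := fun t ht => by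
    have := norm_sq_add_integral_le ha (hD_cont.const_mul c) h t ht
    rw [intervalIntegral.integral_const_mul] at this
    nlinarith [ht.2]
  have hsup (t : Icc 0 T) : ∫ y in U, u t y ^ 2 ≤ A := by
    have hint : 0 ≤ ∫ s in 0..(t : ℝ), D s :=
      intervalIntegral.integral_nonneg t.2.1 fun s _ => hD_nonneg s
    nlinarith [henergy t t.2, hu_sq t]
  have hgrad : ∫ s in Icc 0 T, D s ≤ A / (2 * c) := by
    rw [integral_Icc_eq_integral_Ioc, ← intervalIntegral.integral_of_le hT,
      le_div_iff₀ (by positivity)]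
    nlinarith [henergy T (right_mem_Icc.2 hT), sq_nonneg ‖a T‖]
  have : Nonempty (Icc 0 T) := ⟨0, left_mem_Icc.2 hT⟩
  refine ⟨⟨A, forall_mem_range.2 hsup⟩,
    (integrableOn_congr_fun hu_grad measurableSet_Icc).1 (hD_cont.integrableOn_Icc),
    add_le_add (ciSup_le hsup) ?_⟩
  rwa [← setIntegral_congr_fun measurableSet_Icc hu_grad]

end GalerkinSolutions

section GlobalSolutions

variable {U : Set Plane} {φ : ℝ → ℝ} {ε η T : ℝ} {g u₀ z₀ : Plane → ℝ} {e : ℕ → Plane → ℝ}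
  {N : ℕ} {I J : Set ℝ} {u z u' z' : ℝ → Plane → ℝ}

lemma IsGalerkinSolution.mono (h : IsGalerkinSolution U φ ε η g u₀ z₀ e N J u z) (hIJ : I ⊆ J) :
    IsGalerkinSolution U φ ε η g u₀ z₀ e N I u z := by
  obtain ⟨gN, hgN, hequ⟩ := h.eq_u
  exact ⟨fun t ht => h.mem_u t (hIJ ht), fun t ht => h.mem_z t (hIJ ht), h.init_u, h.init_z,
    ⟨gN, hgN, fun t ht ψ hψ => (hequ t (hIJ ht) ψ hψ).mono hIJ⟩,
    fun t ht ψ hψ => (h.eq_z t (hIJ ht) ψ hψ).mono hIJ⟩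

variable [IsFiniteMeasure (volume.restrict U)]

lemma exists_isL2Chart_galerkinSpace (hU : IsOpen U) (he : ∀ i, IsBoundedC1On (e i) U) (N : ℕ) :
    ∃ (n : ℕ) (k : Plane → EuclideanSpace ℝ (Fin n)), IsL2Chart volume U (galerkinSpace e N) k := by
  have : FiniteDimensional ℝ (galerkinSpace e N) :=
    .span_of_finite ℝ ((finite_lt_nat N).image e)
  exact exists_isL2Chart hU _ fun v =>
    .of_mem_span hU (forall_mem_image.2 fun i _ => he i)

theorem IsGalerkinSolution.energyBound_u (h : IsGalerkinSolution U φ ε η g u₀ z₀ e N (Icc 0 T) u z)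
    (hU : IsOpen U) (he : ∀ i, IsBoundedC1On (e i) U) (hφ : ContDiff ℝ 2 φ) (hη : 0 < η)
    (hT : 0 ≤ T) (hg : MemLp g 2 (volume.restrict U)) (hu₀ : MemLp u₀ 2 (volume.restrict U))
    (hz₀ : MemLp z₀ 2 (volume.restrict U)) :
    EnergyBound U (Icc 0 T) u (((∫ y in U, u₀ y ^ 2) + T * ∫ y in U, g y ^ 2) +
      ((∫ y in U, u₀ y ^ 2) + T * ∫ y in U, g y ^ 2) / (2 * η)) := by
  obtain ⟨n, k, hk⟩ := exists_isL2Chart_galerkinSpace hU he N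
  obtain ⟨x, hu, -, hx0, hx⟩ :=
    h.exists_isIntegralCurveOn hk hU hφ hg hu₀ hz₀ (left_mem_Icc.2 hT)
  refine energyBound_of_inner_le hk hU hu
    (fun t ht => (hasDerivWithinAt_withLp_prod_iff.1 (hx t ht)).1) hη (by positivity) hT
    (fun t _ => inner_galerkinField_fst_self_le (hk.memLp_top_jet hU) (hφ.of_le one_le_two) _) ?_
  have hinit : ‖(x 0).fst‖ ^ 2 ≤ ∫ y in U, u₀ y ^ 2 := by
    rw [congrArg WithLp.fst hx0]
    exact hk.norm_coord_sq_le hU hu₀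
  nlinarith [hk.norm_coord_sq_le hU hg]

theorem IsGalerkinSolution.energyBound_z (h : IsGalerkinSolution U φ ε η g u₀ z₀ e N (Icc 0 T) u z)
    (hU : IsOpen U) (he : ∀ i, IsBoundedC1On (e i) U) (hφ : ContDiff ℝ 2 φ)
    (hφs : ∀ s, 0 ≤ deriv φ s * φ s * s) (hε : 0 < ε)
    (hT : 0 ≤ T) (hg : MemLp g 2 (volume.restrict U)) (hu₀ : MemLp u₀ 2 (volume.restrict U))
    (hz₀ : MemLp z₀ 2 (volume.restrict U)) :
    EnergyBound U (Icc 0 T) z (((∫ y in U, z₀ y ^ 2) + T * volume.real U / (4 * ε)) +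
      ((∫ y in U, z₀ y ^ 2) + T * volume.real U / (4 * ε)) / (2 * (2 * ε))) := by
  obtain ⟨n, k, hk⟩ := exists_isL2Chart_galerkinSpace hU he N
  obtain ⟨x, -, hz, hx0, hx⟩ :=
    h.exists_isIntegralCurveOn hk hU hφ hg hu₀ hz₀ (left_mem_Icc.2 hT)
  refine energyBound_of_inner_le hk hU hz
    (fun t ht => (hasDerivWithinAt_withLp_prod_iff.1 (hx t ht)).2) (by positivity) (by positivity)
    hT (fun t _ => inner_galerkinField_snd_self_le (hk.memLp_top_jet hU) hφ hφs hε _) ?_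
  rw [congrArg WithLp.snd hx0, measureReal_restrict_apply_univ]
  refine (add_le_add_left (hk.norm_coord_sq_le hU hz₀) _).trans_eq ?_
  field_simp
  ring

theorem IsGalerkinSolution.eqOn (h : IsGalerkinSolution U φ ε η g u₀ z₀ e N J u z)
    (h' : IsGalerkinSolution U φ ε η g u₀ z₀ e N J u' z') (hU : IsOpen U)
    (he : ∀ i, IsBoundedC1On (e i) U) (hφ : ContDiff ℝ 2 φ) (hg : MemLp g 2 (volume.restrict U))
    (hu₀ : MemLp u₀ 2 (volume.restrict U)) (hz₀ : MemLp z₀ 2 (volume.restrict U)) {t : ℝ}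
    (ht : 0 ≤ t) (htJ : Icc 0 t ⊆ J) : EqOn (u t) (u' t) U ∧ EqOn (z t) (z' t) U := by
  obtain ⟨n, k, hk⟩ := exists_isL2Chart_galerkinSpace hU he N
  have h0 : 0 ∈ Icc 0 t := left_mem_Icc.2 ht
  have ht : t ∈ Icc 0 t := right_mem_Icc.2 ht
  obtain ⟨x, hu, hz, hx0, hx⟩ := (h.mono htJ).exists_isIntegralCurveOn hk hU hφ hg hu₀ hz₀ h0
  obtain ⟨x', hu', hz', hx0', hx'⟩ :=
    (h'.mono htJ).exists_isIntegralCurveOn hk hU hφ hg hu₀ hz₀ h0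
  have hxx' : x t = x' t := eqOn_of_isIntegralCurveOn_Icc
    (locallyLipschitz_galerkinField (hk.memLp_top_jet hU) hφ) hx hx' (hx0.trans hx0'.symm) ht
  have hu_eq := hu.eqOn t ht
  have hz_eq := hz.eqOn t ht
  rw [hxx'] at hu_eq hz_eq
  exact ⟨hu_eq.trans (hu'.eqOn t ht).symm, hz_eq.trans (hz'.eqOn t ht).symm⟩

theorem exists_isGalerkinSolution_Icc (hU : IsOpen U) (he : ∀ i, IsBoundedC1On (e i) U)
    (hφ : ContDiff ℝ 2 φ) (hφs : ∀ s, 0 ≤ deriv φ s * φ s * s) (hε : 0 < ε) (hη : 0 ≤ η)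
    (hT : 0 ≤ T) (hg : MemLp g 2 (volume.restrict U)) (hu₀ : MemLp u₀ 2 (volume.restrict U))
    (hz₀ : MemLp z₀ 2 (volume.restrict U)) (N : ℕ) :
    ∃ u z, IsGalerkinSolution U φ ε η g u₀ z₀ e N (Icc 0 T) u z := by
  obtain ⟨n, k, hk⟩ := exists_isL2Chart_galerkinSpace hU he N
  have hm := hk.memLp_top_jet hU
  set γ := coord (volume.restrict U) k g
  have hle (x) : ⟪galerkinField (volume.restrict U) (jet k) φ ε η γ x, x⟫ ≤
      ‖γ‖ ^ 2 / 2 + (volume.restrict U).real univ / (8 * ε) := by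
    have hD (a) : 0 ≤ dirichletEnergy (volume.restrict U) (jet k) a :=
      integral_nonneg fun y => sq_nonneg _
    rw [WithLp.prod_inner_apply]
    refine add_le_add ((inner_galerkinField_fst_self_le hm (hφ.of_le one_le_two) x).trans ?_)
      ((inner_galerkinField_snd_self_le hm hφ hφs hε x).trans ?_)
    · exact sub_le_self _ (mul_nonneg hη (hD _))
    · exact sub_le_self _ (mul_nonneg (by positivity) (hD _))
  obtain ⟨x, hx0, hx⟩ := exists_isIntegralCurveOn_of_inner_le
    (locallyLipschitz_galerkinField hm hφ) hle
    (.toLp 2 (coord (volume.restrict U) k u₀, coord (volume.restrict U) k z₀)) hT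
  exact ⟨_, _, (isGalerkinSolution_iff hk hU hφ hg hu₀ hz₀ (left_mem_Icc.2 hT)
    (hk.hasCoords_ofCoord _) (hk.hasCoords_ofCoord _)).2 ⟨hx0, hx⟩⟩

end GlobalSolutions

section Hypotheses

variable {U : Set Plane} {φ : ℝ → ℝ}

lemma IsNeumannEigenfunction.isBoundedC1On {lam : ℝ} {e : Plane → ℝ}
    (he : IsNeumannEigenfunction U lam e) (hU : Bornology.IsBounded U) : IsBoundedC1On e U := by
  obtain ⟨G, hG, hGe, -⟩ := he.neumann
  obtain ⟨C, hC⟩ := hU.isCompact_closure.exists_bound_of_continuousOn he.continuousOn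
  obtain ⟨C', hC'⟩ := hU.isCompact_closure.exists_bound_of_continuousOn hG
  refine ⟨he.contDiffOn.of_le one_le_two, ⟨C, fun y hy => hC y (subset_closure hy)⟩,
    ⟨C', fun y hy => ?_⟩⟩
  have hgrad : ‖gradient e y‖ = ‖fderiv ℝ e y‖ :=
    (InnerProductSpace.toDual ℝ Plane).symm.norm_map _
  rw [← hgrad, ← hGe hy]
  exact hC' y (subset_closure hy)

lemma IsCutoff.map_zero (hφ : IsCutoff φ) : φ 0 = 0 := by
  have hev : φ =ᶠ[𝓝[>] 0] id := by
    filter_upwards [Ioo_mem_nhdsGT one_pos] with s hs using hφ.middle s hs.1 hs.2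
  exact tendsto_nhds_unique (hφ.contDiff.continuous.continuousWithinAt.tendsto)
    (continuousWithinAt_id.tendsto.congr' hev.symm)

lemma IsCutoff.deriv_mul_mul_self_nonneg (hφ : IsCutoff φ) (s : ℝ) :
    0 ≤ deriv φ s * φ s * s := by
  rw [mul_assoc]
  refine mul_nonneg hφ.monotone.deriv_nonneg ?_
  have hφ₀ := hφ.map_zero
  rcases le_total 0 s with hs | hs
  · exact mul_nonneg (hφ₀ ▸ hφ.monotone hs) hs
  · exact mul_nonneg_of_nonpos_of_nonpos (hφ₀ ▸ hφ.monotone hs) hs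

end Hypotheses

theorem proposition2p5_general {U : Set Plane} (hU : IsOpen U) (hU_fin : volume U ≠ ⊤)
    {φ : ℝ → ℝ} (hφ : ContDiff ℝ 2 φ) (hφs : ∀ s, 0 ≤ deriv φ s * φ s * s) {ε η T : ℝ}
    (hε : 0 < ε) (hη : 0 < η) (hT : 0 ≤ T) {g u₀ z₀ : Plane → ℝ}
    (hg : MemLp g 2 (volume.restrict U)) (hu₀ : MemLp u₀ 2 (volume.restrict U))
    (hz₀ : MemLp z₀ 2 (volume.restrict U)) {e : ℕ → Plane → ℝ}
    (he : ∀ i, IsBoundedC1On (e i) U) :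
    ∃ C : ℝ, 0 < C ∧ ∀ N : ℕ,
      (∀ τ : ℝ, 0 < τ → τ ≤ T → ∀ J : Set ℝ, (J = Ico 0 τ ∨ J = Icc 0 τ) →
        ∀ u z : ℝ → Plane → ℝ, IsGalerkinSolution U φ ε η g u₀ z₀ e N J u z →
          EnergyBound U J u C ∧ EnergyBound U J z C ∧
          ∃ u' z' : ℝ → Plane → ℝ,
            IsGalerkinSolution U φ ε η g u₀ z₀ e N (Icc 0 T) u' z' ∧
            (∀ t ∈ J, EqOn (u' t) (u t) U ∧ EqOn (z' t) (z t) U) ∧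
            EnergyBound U (Icc 0 T) u' C ∧ EnergyBound U (Icc 0 T) z' C) ∧
      ∃ u z : ℝ → Plane → ℝ, IsGalerkinSolution U φ ε η g u₀ z₀ e N (Icc 0 T) u z ∧
        EnergyBound U (Icc 0 T) u C ∧ EnergyBound U (Icc 0 T) z C := by
  have : IsFiniteMeasure (volume.restrict U) := isFiniteMeasure_restrict.2 hU_fin
  set A := (∫ y in U, u₀ y ^ 2) + T * ∫ y in U, g y ^ 2
  set B := (∫ y in U, z₀ y ^ 2) + T * volume.real U / (4 * ε)
  obtain ⟨C, hC, hAC, hBC⟩ : ∃ C, 0 < C ∧ A + A / (2 * η) ≤ C ∧ B + B / (2 * (2 * ε)) ≤ C :=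
    ⟨max 1 (max _ _), by positivity, (le_max_left _ _).trans (le_max_right _ _),
      (le_max_right _ _).trans (le_max_right _ _)⟩
  refine ⟨C, hC, fun N => ?_⟩
  obtain ⟨u', z', h'⟩ := exists_isGalerkinSolution_Icc hU he hφ hφs hε hη.le hT hg hu₀ hz₀ N
  have hu' := (h'.energyBound_u hU he hφ hη hT hg hu₀ hz₀).mono hAC
  have hz' := (h'.energyBound_z hU he hφ hφs hε hT hg hu₀ hz₀).mono hBC
  refine ⟨fun τ hτ hτT J hJ u z h => ?_, u', z', h', hu', hz'⟩
  have hJ_conn : J.OrdConnected := by rcases hJ with rfl | rfl <;> infer_instance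
  have hJT : J ⊆ Icc 0 T := by grind
  have h0J : 0 ∈ J := by grind
  have heq : ∀ t ∈ J, EqOn (u' t) (u t) U ∧ EqOn (z' t) (z t) U := fun t ht =>
    (h'.mono hJT).eqOn h hU he hφ hg hu₀ hz₀ (hJT ht).1 (hJ_conn.out h0J ht)
  exact ⟨(hu'.mono_set hJT).congr hU hJ_conn.measurableSet fun t ht => (heq t ht).1,
    (hz'.mono_set hJT).congr hU hJ_conn.measurableSet fun t ht => (heq t ht).2,
    u', z', h', heq, hu', hz'⟩

end AmbrosioTortorelli

theorem proposition2p5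
    (U : Set AmbrosioTortorelli.Plane) (hU : AmbrosioTortorelli.IsBoundedC2Domain U)
    (φ : ℝ → ℝ) (hφ : AmbrosioTortorelli.IsCutoff φ)
    (ε η T : ℝ) (hε : 0 < ε) (hη : 0 < η) (hT : 0 < T)
    (g u₀ z₀ : AmbrosioTortorelli.Plane → ℝ)
    (hg : MeasureTheory.MemLp g 2 (MeasureTheory.volume.restrict U))
    (hu₀ : MeasureTheory.MemLp u₀ 2 (MeasureTheory.volume.restrict U))
    (hz₀ : MeasureTheory.MemLp z₀ 2 (MeasureTheory.volume.restrict U))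
    (lam : ℕ → ℝ) (e : ℕ → AmbrosioTortorelli.Plane → ℝ)
    (he : AmbrosioTortorelli.IsNeumannEigenbasis U lam e) :
    ∃ C : ℝ, 0 < C ∧ ∀ N : ℕ,
      -- every local solution satisfies the bounds and extends to the whole of `[0, T]`
      (∀ τ : ℝ, 0 < τ → τ ≤ T → ∀ J : Set ℝ, (J = Set.Ico 0 τ ∨ J = Set.Icc 0 τ) →
        ∀ u z : ℝ → AmbrosioTortorelli.Plane → ℝ,
          AmbrosioTortorelli.IsGalerkinSolution U φ ε η g u₀ z₀ e N J u z →
          AmbrosioTortorelli.EnergyBound U J u C ∧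
          AmbrosioTortorelli.EnergyBound U J z C ∧
          ∃ u' z' : ℝ → AmbrosioTortorelli.Plane → ℝ,
            AmbrosioTortorelli.IsGalerkinSolution U φ ε η g u₀ z₀ e N (Set.Icc 0 T) u' z' ∧
            (∀ t ∈ J, Set.EqOn (u' t) (u t) U ∧ Set.EqOn (z' t) (z t) U) ∧
            AmbrosioTortorelli.EnergyBound U (Set.Icc 0 T) u' C ∧
            AmbrosioTortorelli.EnergyBound U (Set.Icc 0 T) z' C) ∧
      -- a solution on `[0, T]` exists, with the same bounds
      ∃ u z : ℝ → AmbrosioTortorelli.Plane → ℝ,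
        AmbrosioTortorelli.IsGalerkinSolution U φ ε η g u₀ z₀ e N (Set.Icc 0 T) u z ∧
        AmbrosioTortorelli.EnergyBound U (Set.Icc 0 T) u C ∧
        AmbrosioTortorelli.EnergyBound U (Set.Icc 0 T) z C :=
  AmbrosioTortorelli.proposition2p5_general hU.isOpen hU.isBounded.measure_lt_top.ne
    (contDiff_infty.1 hφ.contDiff 2) hφ.deriv_mul_mul_self_nonneg hε hη hT.le hg hu₀ hz₀
    fun i => (he.eigenfunction i).isBoundedC1On hU.isBounded
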